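/- **Conventions.** Let $\Sigma$ be a finite alphabet. All automata are complete deterministic finite automata $\mathcal A=(S,\Sigma,\iota,F,\delta)$; $|\mathcal A|=|S|$ is the size of $\mathcal A$ and $L(\mathcal A)\subseteq\Sigma^*$ its language. $\mathcal A$ is *minimal* if no smaller automaton recognizes $L(\mathcal A)$. A language $L$ is an *ideal* if $L$ is equal to its shuffle with $\Sigma^*$ (equivalently, every word having a subword, i.e. scattered subsequence, in $L$ is itself in $L$). Write $q\preccurlyeq r$ if $r=\delta(q,w)$ for some $w\in\Sigma^*$. $\mathcal A$ is *trim* if every state is accessible from $\iota$ and a final state is accessible from every state; it is *linear* if $\preccurlyeq$ is a total order on $S$. For linear $\mathcal A$ we write $S=\{q_0,\dots,q_n\}$, where the $q_i$ are distinct and $q_i\preccurlyeq q_j$ iff $i\le j$, and $\Sigma_{i,j}=\{a\in\Sigma : \delta(q_i,a)=q_j\}$. A linear $\mathcal A$ has a *damping pattern* between $q_{k-1}$ and $q_k$, where $1\le k\le n-1$ (so the greatest state $q_n$ is not involved), if $\Sigma_{k-1,k-1}\cup\Sigma_{k-1,k}\subseteq\Sigma_{k,k}$. For $0\le k\le n-1$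 the *reduced automaton* $\mathcal A_k$ has state set $S\setminus\{q_k\}$ and final set $\{q_n\}$; it is obtained from $\mathcal A$ by removing $q_k$ and redirecting to $q_{k+1}$ all transitions leading to $q_k$; its initial state is $\iota$ if $\iota\ne q_k$, and $q_{k+1}$ otherwise. A *decomposition* of $\mathcal A$ is a nonempty finite sequence of automata $\mathcal B_1,\dots,\mathcal B_m$ with $|\mathcal B_i|<|\mathcal A|$ for all $i$ and $L(\mathcal A)=\bigcap_{i}L(\mathcal B_i)$. $\mathcal A$ is *composite* if it has a decomposition, and *prime* otherwise. **Theorem.** Let $\mathcal A$ be a minimal automaton recognizing an ideal. 1. $\mathcal A$ is prime if and only if it is linear and has no damping pattern. 2. If $\mathcal A$ is composite and linear, then it has a decomposition into two trim linear automata recognizing ideals. More precisely, $\mathcal A$ then has a damping pattern, and for every damping pattern, between $q_{k-1}$ and $q_k$, the reduced automata $\mathcal A_{k-1},\mathcal A_k$ are trim and linear, recognize ideals, and form a decomposition of $\mathcal A$. 3. If $\mathcal A$ is not linear, then it has a decomposition into at most $|\Sigma|$ trim automata, each recognizing an ideal. -/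

import Mathlib

universe u v

/-- `IsShuffle x y w`: the word `w` belongs to the shuffle of the words `x` and `y`, i.e. `w` is an
interleaving of `x` and `y`. -/
inductive IsShuffle {α : Type u} : List α → List α → List α → Prop
  | nil : IsShuffle [] [] []
  | left (a : α) {x y w : List α} : IsShuffle x y w → IsShuffle (a :: x) y (a :: w)
  | right (a : α) {x y w : List α} : IsShuffle x y w → IsShuffle x (a :: y) (a :: w)

/-- The shuffle of two languages. -/
def Language.shuffle {α : Type u} (L₁ L₂ : Language α) : Language α :=
  {w | ∃ x ∈ L₁, ∃ y ∈ L₂, IsShuffle x y w}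

/-- A language `L` is an ideal if its shuffle with the language of all words is `L` itself. -/
def Language.IsIdeal {α : Type u} (L : Language α) : Prop :=
  L.shuffle (Set.univ : Set (List α)) = L

/-- The words `w` obtained by shuffling `x` with some word are the upper-words of `x`. -/
theorem exists_isShuffle_iff_sublist {α : Type u} {x w : List α} :
    (∃ y, IsShuffle x y w) ↔ x.Sublist w := by
  constructor
  · rintro ⟨y, h⟩
    induction h with
    | nil => exact List.Sublist.refl _
    | left a _ ih => exact ih.cons_cons a
    | right a _ ih => exact ih.cons a
  · intro h
    induction h with
    | slnil => exact ⟨[], IsShuffle.nil⟩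
    | cons a _ ih =>
      obtain ⟨y, hy⟩ := ih
      exact ⟨a :: y, IsShuffle.right a hy⟩
    | cons_cons a _ ih =>
      obtain ⟨y, hy⟩ := ih
      exact ⟨y, IsShuffle.left a hy⟩

/-- Ideals are exactly the languages that are closed under upper-words. -/
theorem Language.isIdeal_iff {α : Type u} {L : Language α} :
    L.IsIdeal ↔ ∀ x ∈ L, ∀ w : List α, x.Sublist w → w ∈ L := by
  constructor
  · intro h x hx w hw
    obtain ⟨y, hy⟩ := exists_isShuffle_iff_sublist.2 hw
    rw [← h]
    exact ⟨x, hx, y, Set.mem_univ y, hy⟩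
  · intro h
    apply Set.ext
    intro w
    constructor
    · rintro ⟨x, hx, y, -, hy⟩
      exact h x hx w (exists_isShuffle_iff_sublist.1 ⟨y, hy⟩)
    · intro hw
      obtain ⟨y, hy⟩ := exists_isShuffle_iff_sublist.2 (List.Sublist.refl w)
      exact ⟨w, hw, y, Set.mem_univ y, hy⟩

/-- A complete deterministic finite automaton over the alphabet `α`, bundled with its finite set of
states. -/
structure FinAutomaton (α : Type u) : Type (max u (v + 1)) where
  /-- the set of states -/
  State : Type v
  /-- there are finitely many states -/
  finite : Finite State
  /-- the transition function, the initial state and the final states -/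
  dfa : DFA α State

namespace FinAutomaton

variable {α : Type u}

/-- The language recognized by the automaton. -/
def lang (A : FinAutomaton.{u, v} α) : Language α := A.dfa.accepts

/-- The size of an automaton is its number of states. -/
noncomputable def size (A : FinAutomaton.{u, v} α) : ℕ := Nat.card A.State

/-- No smaller automaton recognizes the same language. -/
def IsMinimal (A : FinAutomaton.{u, v} α) : Prop :=
  ∀ B : FinAutomaton.{u, v} α, B.lang = A.lang → A.size ≤ B.size

/-- `A.Acc q r`: the state `r` is accessible from the state `q`. -/
def Acc (A : FinAutomaton.{u, v} α) (q r : A.State) : Prop :=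
  ∃ w : List α, A.dfa.evalFrom q w = r

/-- Every state is accessible from the initial state, and a final state is accessible from every
state. -/
def IsTrim (A : FinAutomaton.{u, v} α) : Prop :=
  (∀ q, A.Acc A.dfa.start q) ∧ ∀ q, ∃ r ∈ A.dfa.accept, A.Acc q r

/-- Accessibility is a total order on the set of states. -/
def IsLinear (A : FinAutomaton.{u, v} α) : Prop :=
  IsLinearOrder A.State A.Acc

/-- The (nonempty) finite sequence `B` is an intersection decomposition of `A`. -/
def IsDecomposition (A : FinAutomaton.{u, v} α) {m : ℕ} (B : Fin m → FinAutomaton.{u, v} α) :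
    Prop :=
  0 < m ∧ (∀ i, (B i).size < A.size) ∧ ∀ w : List α, w ∈ A.lang ↔ ∀ i, w ∈ (B i).lang

/-- `A` is composite (for intersection). -/
def IsComposite (A : FinAutomaton.{u, v} α) : Prop :=
  ∃ (m : ℕ) (B : Fin m → FinAutomaton.{u, v} α), A.IsDecomposition B

/-- `A` is prime (for intersection). -/
def IsPrime (A : FinAutomaton.{u, v} α) : Prop := ¬ A.IsComposite

/-- The set of letters that label a transition from `q` to `r`. -/
def letters (A : FinAutomaton.{u, v} α) (q r : A.State) : Set α := {a | A.dfa.step q a = r}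

/-- An enumeration `q₀, …, qₙ` of the states of a linear automaton such that `qⱼ` is accessible
from `qᵢ` if and only if `i ≤ j`. -/
structure Enumeration (A : FinAutomaton.{u, v} α) (n : ℕ) where
  /-- the states `q₀, …, qₙ`, without repetition -/
  q : Fin (n + 1) ≃ A.State
  /-- the enumeration agrees with the accessibility order -/
  acc_iff : ∀ i j : Fin (n + 1), A.Acc (q i) (q j) ↔ i ≤ j

namespace Enumeration

variable {A : FinAutomaton.{u, v} α} {n : ℕ}

/-- `A` has a damping pattern between the consecutive states `qᵢ` and `qⱼ`, `j = i + 1`. The indices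
range over `0, …, n - 1`, so that the greatest state `qₙ` never takes part in a damping pattern. -/
def IsDampingPattern (e : A.Enumeration n) (i j : Fin n) : Prop :=
  (j : ℕ) = (i : ℕ) + 1 ∧
    A.letters (e.q i.castSucc) (e.q i.castSucc) ∪ A.letters (e.q i.castSucc) (e.q j.castSucc) ⊆
      A.letters (e.q j.castSucc) (e.q j.castSucc)

open Classical in
/-- For a state `s`, the state `s` itself if `s ≠ qₖ`, and `qₖ₊₁` if `s = qₖ`. -/
noncomputable def redirect (e : A.Enumeration n) (k : Fin n) (s : A.State) :
    {s : A.State // s ≠ e.q k.castSucc} :=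
  if h : s = e.q k.castSucc then
    ⟨e.q k.succ, fun h' => (Fin.castSucc_lt_succ (i := k)).ne' (e.q.injective h')⟩
  else ⟨s, h⟩

/-- The reduced automaton `Aₖ`, for `0 ≤ k ≤ n - 1`: the state `qₖ` is removed, the transitions to
`qₖ` are redirected to `qₖ₊₁`, the initial state is the one of `A` (and `q₁` if that is `qₖ`), and
`qₙ` is the final state. -/
noncomputable def reduced (e : A.Enumeration n) (k : Fin n) : FinAutomaton.{u, v} α where
  State := {s : A.State // s ≠ e.q k.castSucc}
  finite := haveI := A.finite; inferInstance
  dfa :=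
    { step := fun s a => e.redirect k (A.dfa.step s.1 a)
      start := e.redirect k A.dfa.start
      accept := {s | s.1 = e.q (Fin.last n)} }

end Enumeration

/-- `A` has a damping pattern, between two consecutive states of the enumeration of its states. -/
def HasDampingPattern (A : FinAutomaton.{u, v} α) : Prop :=
  ∃ (n : ℕ) (e : A.Enumeration n) (i j : Fin n), e.IsDampingPattern i j

end FinAutomaton

namespace FinAutomaton

variable {α : Type u} {A : FinAutomaton.{u, v} α}

/-! Write `L(q)` for the language accepted from `q`. In a minimal automaton distinct states have
distinct `L`, and for an ideal `L` grows along transitions (`acceptsFrom_le_of_acc`). Hence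
accessibility is a partial order and the transitions are monotone for inclusion of the `L(q)`.

If the order is not total, take a maximal trunk state `q`, where the order starts to branch. For
each letter `a` moving `q`, keep only the states below `q` or above its `a`-successor `r`, and send
each transition to the least available successor. This can only enlarge the language
(`lang_le_restrict`), loses a state by maximality of `q` (`branch_size_lt`), and for every word some
branch reaches the same state as `A` (`exists_branch_eval`).

If the order is total without damping pattern, there are words `xⱼ` leading from `qⱼ` to `qⱼ₊₁` that
also push every higher state up, as long as `j + 1 < n`. By pigeonhole, any smaller automaton whose
language contains that of `A` accepts the rejected word `x₀ ⋯ xₙ₋₂` (`isPrime_of_words`).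

With a damping pattern, on every word one of the two reduced automata follows `A` closely enough to
decide acceptance (`IsDampingPattern.rank_evalFrom`). -/

theorem acc_refl (q : A.State) : A.Acc q q := ⟨[], rfl⟩

theorem Acc.trans {p q r : A.State} (h₁ : A.Acc p q) (h₂ : A.Acc q r) : A.Acc p r := by
  obtain ⟨x, rfl⟩ := h₁
  obtain ⟨y, rfl⟩ := h₂
  exact ⟨x ++ y, DFA.evalFrom_of_append _ _ _ _⟩

theorem acc_step (q : A.State) (a : α) : A.Acc q (A.dfa.step q a) := ⟨[a], rfl⟩

theorem mem_lang_iff {w : List α} :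
    w ∈ A.lang ↔ A.dfa.evalFrom A.dfa.start w ∈ A.dfa.accept := Iff.rfl

/-- A sufficient condition for a language to be an ideal: a relation between the states that is
compatible with the transitions and such that reading a letter leads to a greater state. -/
theorem isIdeal_of_monotone (R : A.State → A.State → Prop) (hrefl : R A.dfa.start A.dfa.start)
    (hstep : ∀ q r a, R q r → R (A.dfa.step q a) (A.dfa.step r a))
    (hinfl : ∀ q r a, R q r → R q (A.dfa.step r a))
    (hacc : ∀ q r, R q r → q ∈ A.dfa.accept → r ∈ A.dfa.accept) : A.lang.IsIdeal := by
  have key : ∀ x w : List α, x.Sublist w → ∀ q r, R q r →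
      R (A.dfa.evalFrom q x) (A.dfa.evalFrom r w) := by
    intro x w h
    induction h with
    | slnil => exact fun q r h => h
    | cons a _ ih => exact fun q r h => ih _ _ (hinfl q r a h)
    | cons_cons a _ ih => exact fun q r h => ih _ _ (hstep q r a h)
  rw [Language.isIdeal_iff]
  exact fun x hx w hw => hacc _ _ (key x w hw _ _ hrefl) hx

theorem acceptsFrom_step_mono {q r : A.State} (h : A.dfa.acceptsFrom q ≤ A.dfa.acceptsFrom r)
    (a : α) : A.dfa.acceptsFrom (A.dfa.step q a) ≤ A.dfa.acceptsFrom (A.dfa.step r a) :=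
  fun w hw => h (show a :: w ∈ A.dfa.acceptsFrom q from hw)

/-! ### Minimality: accessible and pairwise inequivalent states -/

/-- The subautomaton of the accessible states. -/
def accessiblePart (A : FinAutomaton.{u, v} α) : FinAutomaton.{u, v} α where
  State := {q // A.Acc A.dfa.start q}
  finite := haveI := A.finite; inferInstance
  dfa :=
    { step := fun q a => ⟨A.dfa.step q.1 a, q.2.trans (acc_step _ _)⟩
      start := ⟨A.dfa.start, acc_refl _⟩
      accept := {q | q.1 ∈ A.dfa.accept} }

theorem accessiblePart_lang : A.accessiblePart.lang = A.lang := by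
  have key : ∀ (w : List α) (q : A.accessiblePart.State),
      (A.accessiblePart.dfa.evalFrom q w).1 = A.dfa.evalFrom q.1 w := by
    intro w
    induction w with
    | nil => exact fun q => rfl
    | cons a w ih => exact fun q => ih _
  apply Language.ext
  intro w
  change (A.accessiblePart.dfa.evalFrom _ w).1 ∈ A.dfa.accept ↔ _
  rw [key]
  rfl

/-- Two states are equivalent if they have the same language. -/
def nerodeSetoid (A : FinAutomaton.{u, v} α) : Setoid A.State :=
  Setoid.ker A.dfa.acceptsFrom

/-- The automaton obtained by merging the states with the same language. -/
def nerodeQuotient (A : FinAutomaton.{u, v} α) : FinAutomaton.{u, v} α where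
  State := Quotient A.nerodeSetoid
  finite := haveI := A.finite; inferInstance
  dfa :=
    { step := fun q a => Quotient.map (fun q => A.dfa.step q a)
        (fun q r (h : A.dfa.acceptsFrom q = A.dfa.acceptsFrom r) =>
          le_antisymm (acceptsFrom_step_mono h.le a) (acceptsFrom_step_mono h.ge a)) q
      start := Quotient.mk _ A.dfa.start
      accept := {q | ∃ r ∈ A.dfa.accept, Quotient.mk _ r = q} }

theorem nerodeQuotient_lang : A.nerodeQuotient.lang = A.lang := by
  have key : ∀ (w : List α) (q : A.State),
      A.nerodeQuotient.dfa.evalFrom (Quotient.mk _ q) w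
        = Quotient.mk A.nerodeSetoid (A.dfa.evalFrom q w) := by
    intro w
    induction w with
    | nil => exact fun q => rfl
    | cons a w ih => exact fun q => ih _
  apply Language.ext
  intro w
  rw [mem_lang_iff]
  change A.nerodeQuotient.dfa.evalFrom (Quotient.mk _ A.dfa.start) w ∈ A.nerodeQuotient.dfa.accept ↔ _
  rw [key]
  constructor
  · rintro ⟨r, hr, h⟩
    have h' : A.dfa.acceptsFrom r = A.dfa.acceptsFrom _ := Quotient.exact h
    have : ([] : List α) ∈ A.dfa.acceptsFrom r := hr
    rw [h'] at this
    exact this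
  · exact fun h => ⟨_, h, rfl⟩

theorem IsMinimal.acc_start (hmin : A.IsMinimal) (q : A.State) : A.Acc A.dfa.start q := by
  by_contra hq
  have := A.finite
  refine (hmin A.accessiblePart accessiblePart_lang).not_gt ?_
  exact Finite.card_subtype_lt hq

theorem IsMinimal.acceptsFrom_injective (hmin : A.IsMinimal) :
    Function.Injective A.dfa.acceptsFrom := by
  intro q r h
  by_contra hqr
  have := A.finite
  refine (hmin A.nerodeQuotient nerodeQuotient_lang).not_gt ?_
  refine lt_of_le_of_ne (Nat.card_le_card_of_surjective _ Quotient.mk_surjective) fun hc => hqr ?_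
  exact ((Nat.bijective_iff_surjective_and_card _).2 ⟨Quotient.mk_surjective, hc.symm⟩).1
    (Quotient.sound (s := A.nerodeSetoid) h)

/-! ### Minimal automata of ideals: accessibility and inclusion -/

theorem acceptsFrom_le_of_acc (hmin : A.IsMinimal) (hideal : A.lang.IsIdeal)
    {q r : A.State} (h : A.Acc q r) :
    A.dfa.acceptsFrom q ≤ A.dfa.acceptsFrom r := by
  obtain ⟨x, rfl⟩ := hmin.acc_start q
  obtain ⟨y, rfl⟩ := h
  intro w hw
  have h₁ : x ++ w ∈ A.lang := by
    rw [mem_lang_iff, DFA.evalFrom_of_append]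
    exact hw
  have h₂ : x ++ y ++ w ∈ A.lang := by
    refine Language.isIdeal_iff.1 hideal _ h₁ _ ?_
    rw [List.append_assoc]
    exact (List.Sublist.refl x).append (List.sublist_append_right y w)
  rw [mem_lang_iff, DFA.evalFrom_of_append, DFA.evalFrom_of_append] at h₂
  exact h₂

theorem acc_antisymm (hmin : A.IsMinimal) (hideal : A.lang.IsIdeal)
    {q r : A.State} (h₁ : A.Acc q r) (h₂ : A.Acc r q) : q = r :=
  hmin.acceptsFrom_injective
    (le_antisymm (acceptsFrom_le_of_acc hmin hideal h₁) (acceptsFrom_le_of_acc hmin hideal h₂))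

/-- Two inequivalent states force a nonempty language, and a word of the language is accepted from
every state. The one-state automaton of the empty language is not trim. -/
theorem isTrim_of_ne (hmin : A.IsMinimal) (hideal : A.lang.IsIdeal)
    {p p' : A.State} (hne : p ≠ p') : A.IsTrim := by
  refine ⟨hmin.acc_start, fun q => ?_⟩
  obtain ⟨w, hw⟩ : ∃ w, w ∈ A.lang := by
    by_contra! hw
    refine hne (hmin.acceptsFrom_injective ?_)
    have : ∀ q, A.dfa.acceptsFrom q = (∅ : Set (List α)) := by
      intro q
      obtain ⟨x, rfl⟩ := hmin.acc_start q
      refine Set.eq_empty_iff_forall_notMem.2 fun w h => hw (x ++ w) ?_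
      rw [mem_lang_iff, DFA.evalFrom_of_append]
      exact h
    rw [this, this]
  exact ⟨_, acceptsFrom_le_of_acc hmin hideal (hmin.acc_start q) hw, w, rfl⟩

theorem mem_accept_of_le {q r : A.State} (h : A.dfa.acceptsFrom q ≤ A.dfa.acceptsFrom r)
    (hq : q ∈ A.dfa.accept) : r ∈ A.dfa.accept :=
  h (show [] ∈ A.dfa.acceptsFrom q from hq)

/-- All words are accepted from a final state, so the final state is unique. -/
theorem acc_of_mem_accept (hmin : A.IsMinimal) (hideal : A.lang.IsIdeal)
    {q r : A.State} (h : A.IsTrim) (hr : r ∈ A.dfa.accept) :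
    A.Acc q r := by
  obtain ⟨s, hs, hqs⟩ := h.2 q
  suffices s = r from this ▸ hqs
  apply hmin.acceptsFrom_injective
  have : ∀ t ∈ A.dfa.accept, A.dfa.acceptsFrom t = (Set.univ : Set (List α)) := fun t ht =>
    Set.eq_univ_of_forall fun w => acceptsFrom_le_of_acc hmin hideal
      (q := t) (r := A.dfa.evalFrom t w) ⟨w, rfl⟩ (show [] ∈ A.dfa.acceptsFrom t from ht)
  rw [this s hs, this r hr]

/-! ### Restriction to a set of states -/

/-- The state `s` is the least successor, in `T` and for the inclusion of languages, by the letter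
`a` of the states of `T` that are above `t`. -/
def IsLeastStep (A : FinAutomaton.{u, v} α) (T : Set A.State) (t : A.State) (a : α)
    (s : A.State) : Prop :=
  (∃ g ∈ T, A.dfa.acceptsFrom t ≤ A.dfa.acceptsFrom g ∧ A.dfa.step g a = s) ∧ s ∈ T ∧
    ∀ g ∈ T, A.dfa.acceptsFrom t ≤ A.dfa.acceptsFrom g → A.dfa.step g a ∈ T →
      A.dfa.acceptsFrom s ≤ A.dfa.acceptsFrom (A.dfa.step g a)

/-- The automaton with set of states `T` whose transitions are the least steps in `T`. -/
noncomputable def restrict (A : FinAutomaton.{u, v} α) (T : Set A.State) (hs : A.dfa.start ∈ T)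
    (hl : ∀ (t : T) (a : α), ∃ s, A.IsLeastStep T t a s) : FinAutomaton.{u, v} α where
  State := T
  finite := haveI := A.finite; inferInstance
  dfa :=
    { step := fun t a => ⟨(hl t a).choose, (hl t a).choose_spec.2.1⟩
      start := ⟨A.dfa.start, hs⟩
      accept := {t | t.1 ∈ A.dfa.accept} }

section restrict

variable {T : Set A.State} {hs : A.dfa.start ∈ T}
  {hl : ∀ (t : T) (a : α), ∃ s, A.IsLeastStep T t a s}

theorem restrict_step_spec (t : T) (a : α) :
    A.IsLeastStep T t a ((A.restrict T hs hl).dfa.step t a).1 :=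
  (hl t a).choose_spec

/-- By monotonicity the successor of `t` itself is below those of all other candidates. -/
theorem restrict_step_eq (hmin : A.IsMinimal) {t : T} {a : α} (h : A.dfa.step t.1 a ∈ T) :
    (A.restrict T hs hl).dfa.step t a = ⟨A.dfa.step t.1 a, h⟩ := by
  obtain ⟨⟨g, -, htg, hg⟩, -, h₂⟩ := restrict_step_spec (hs := hs) (hl := hl) t a
  refine Subtype.ext (hmin.acceptsFrom_injective (le_antisymm (h₂ t.1 t.2 le_rfl h) ?_))
  rw [← hg]
  exact acceptsFrom_step_mono htg a

/-- The candidates for a greater state are among those for a smaller one, so least steps are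
monotone for inclusion. -/
theorem restrict_isIdeal (hmin : A.IsMinimal) (hideal : A.lang.IsIdeal) :
    (A.restrict T hs hl).lang.IsIdeal := by
  refine isIdeal_of_monotone (fun q r : T => A.dfa.acceptsFrom q.1 ≤ A.dfa.acceptsFrom r.1)
    le_rfl ?_ ?_ ?_
  · intro q r a h
    obtain ⟨⟨g, hgT, htg, hg⟩, hT, -⟩ := restrict_step_spec (hs := hs) (hl := hl) r a
    have := (restrict_step_spec (hs := hs) (hl := hl) q a).2.2 g hgT (h.trans htg) (hg ▸ hT)
    rw [hg] at this
    exact this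
  · intro q r a h
    obtain ⟨⟨g, hgT, htg, hg⟩, hT, -⟩ := restrict_step_spec (hs := hs) (hl := hl) r a
    refine h.trans (htg.trans ?_)
    rw [← hg]
    exact acceptsFrom_le_of_acc hmin hideal (acc_step g a)
  · exact fun q r h hq => mem_accept_of_le (A := A) h hq

theorem lang_le_restrict {w : List α}
    (hw : w ∈ A.lang) : w ∈ (A.restrict T hs hl).lang := by
  have key : ∀ (w : List α) (q : A.State) (t : T),
      A.dfa.acceptsFrom q ≤ A.dfa.acceptsFrom t.1 →
      A.dfa.acceptsFrom (A.dfa.evalFrom q w) ≤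
        A.dfa.acceptsFrom ((A.restrict T hs hl).dfa.evalFrom t w).1 := by
    intro w
    induction w with
    | nil => exact fun q t h => h
    | cons a w ih =>
      intro q t h
      refine ih _ _ ?_
      obtain ⟨⟨g, -, htg, hg⟩, -⟩ := restrict_step_spec (hs := hs) (hl := hl) t a
      rw [← hg]
      exact acceptsFrom_step_mono (h.trans htg) a
  exact mem_accept_of_le (key w _ ⟨_, hs⟩ le_rfl) hw

/-- If the run of `A` from `q` on `w` stays in `T`, then so does the run of the restriction. -/
theorem restrict_evalFrom (hmin : A.IsMinimal) (w : List α) (q : T)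
    (h : ∀ x, x <+: w → A.dfa.evalFrom q.1 x ∈ T) :
    ((A.restrict T hs hl).dfa.evalFrom q w).1 = A.dfa.evalFrom q.1 w := by
  induction w generalizing q with
  | nil => rfl
  | cons a w ih =>
    have h₁ : A.dfa.step q.1 a ∈ T := h [a] (by simp)
    have := ih ⟨_, h₁⟩ fun x hx => h (a :: x) (by simpa using hx)
    rw [← restrict_step_eq (hs := hs) (hl := hl) hmin h₁] at this
    refine this.trans ?_
    rw [restrict_step_eq (hs := hs) (hl := hl) hmin h₁]
    rfl

end restrict

/-! ### Trunk states and branches -/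

/-- The states from which `q` is accessible, and those that are accessible from `r`. -/
def belowOrAbove (A : FinAutomaton.{u, v} α) (q r : A.State) : Set A.State :=
  {t | A.Acc t q ∨ A.Acc r t}

/-- Every state from which `q` is accessible is comparable with all the states. -/
def IsTrunk (A : FinAutomaton.{u, v} α) (q : A.State) : Prop :=
  ∀ p, A.Acc p q → ∀ s, A.Acc p s ∨ A.Acc s p

/-- Above `r` the steps of `A` stay in the set. Below `q` the candidates up to `r` form a chain,
since `q` is a trunk state, and the least of them has the least successor. -/
theorem exists_isLeastStep (hmin : A.IsMinimal) (hideal : A.lang.IsIdeal) {q r : A.State}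
    (hq : A.IsTrunk q) (hqr : A.Acc q r) (t : A.belowOrAbove q r) (a : α) :
    ∃ s, A.IsLeastStep (A.belowOrAbove q r) t a s := by
  have hle := @acceptsFrom_le_of_acc _ A hmin hideal
  obtain ⟨t, ht⟩ := t
  by_cases hrt : A.Acc r t
  · exact ⟨A.dfa.step t a, ⟨t, ht, le_rfl, rfl⟩, Or.inr (hrt.trans (acc_step _ _)),
      fun g _ hg _ => acceptsFrom_step_mono hg a⟩
  have htq : A.Acc t q := ht.resolve_right hrt
  have := A.finite
  let G : Set A.State := {g | (A.Acc g q ∨ g = r) ∧ A.Acc t g ∧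
    A.dfa.step g a ∈ A.belowOrAbove q r}
  have hG : r ∈ G := ⟨Or.inr rfl, htq.trans hqr, Or.inr (acc_step _ _)⟩
  obtain ⟨g₀, hg₀, hmin₀⟩ := G.toFinite.exists_minimalFor A.dfa.acceptsFrom G ⟨r, hG⟩
  refine ⟨A.dfa.step g₀ a, ⟨g₀, ?_, hle hg₀.2.1, rfl⟩, hg₀.2.2, ?_⟩
  · exact hg₀.1.imp id fun h : g₀ = r => h ▸ acc_refl _
  intro g hg htg hga
  refine acceptsFrom_step_mono ?_ a
  by_cases hgr : A.Acc r g
  · rcases hg₀.1 with h | rfl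
    · exact hle ((h.trans hqr).trans hgr)
    · exact hle hgr
  have hgq : A.Acc g q := hg.resolve_right hgr
  have hcomp : A.Acc g g₀ ∨ A.Acc g₀ g := hq g hgq g₀
  rcases hcomp with h | h
  · refine hmin₀ ⟨Or.inl hgq, ?_, hga⟩ (hle h)
    -- Trunk states turn inclusion of languages back into accessibility.
    rcases hq g hgq t with h' | h'
    · exact hmin.acceptsFrom_injective (le_antisymm htg (hle h')) ▸ acc_refl t
    · exact h'
  · exact hle h

/-- There is a maximal trunk state. -/
theorem exists_maximal_isTrunk (hmin : A.IsMinimal) (hideal : A.lang.IsIdeal) :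
    ∃ q, A.IsTrunk q ∧ ∀ r, A.IsTrunk r → A.Acc q r → r = q := by
  have := A.finite
  have hs : A.IsTrunk A.dfa.start := fun p hp s => Or.inl (hp.trans (hmin.acc_start s))
  obtain ⟨q, hq, hmax⟩ := (Set.toFinite {q | A.IsTrunk q}).exists_maximalFor A.dfa.acceptsFrom _
    ⟨_, hs⟩
  refine ⟨q, hq, fun r hr hqr => hmin.acceptsFrom_injective ?_⟩
  have := acceptsFrom_le_of_acc hmin hideal hqr
  exact le_antisymm (hmax hr this) this

theorem isLinear_of_total (hmin : A.IsMinimal) (hideal : A.lang.IsIdeal)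
    (h : ∀ q r, A.Acc q r ∨ A.Acc r q) : A.IsLinear :=
  { refl := acc_refl
    trans := fun _ _ _ => Acc.trans
    antisymm := fun _ _ => acc_antisymm hmin hideal
    total := h }

theorem exists_letter_of_acc {q s : A.State} (h : A.Acc q s) (hne : q ≠ s) :
    ∃ a, A.dfa.step q a ≠ q ∧ A.Acc (A.dfa.step q a) s := by
  obtain ⟨w, rfl⟩ := h
  induction w with
  | nil => exact absurd rfl hne
  | cons a w ih =>
    by_cases ha : A.dfa.step q a = q
    · have : A.dfa.evalFrom q (a :: w) = A.dfa.evalFrom q w :=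
        congrArg (A.dfa.evalFrom · w) ha
      rw [this] at hne ⊢
      exact ih hne
    · exact ⟨a, ha, w, rfl⟩

/-- A trunk state `q` and a letter `a` that does not fix it give the restriction of `A` to the states
below `q` and to those above its successor by `a`. -/
noncomputable def branch (A : FinAutomaton.{u, v} α) (hmin : A.IsMinimal)
    (hideal : A.lang.IsIdeal) {q : A.State} (hq : A.IsTrunk q) (a : α) : FinAutomaton.{u, v} α :=
  A.restrict (A.belowOrAbove q (A.dfa.step q a)) (Or.inl (hmin.acc_start q))
    (exists_isLeastStep hmin hideal hq (acc_step q a))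

theorem acc_of_isPrefix {q : A.State} {x w : List α} (h : x <+: w) :
    A.Acc (A.dfa.evalFrom q x) (A.dfa.evalFrom q w) := by
  obtain ⟨y, rfl⟩ := h
  exact ⟨y, (DFA.evalFrom_of_append _ _ _ _).symm⟩

section branch

variable {hmin : A.IsMinimal} {hideal : A.lang.IsIdeal} {q : A.State} {hq : A.IsTrunk q}

theorem branch_evalFrom_of_acc {a : α}
    (p : (A.branch hmin hideal hq a).State) (w : List α)
    (h : A.Acc (A.dfa.evalFrom p.1 w) q ∨ A.Acc (A.dfa.step q a) p.1) :
    ((A.branch hmin hideal hq a).dfa.evalFrom p w).1 = A.dfa.evalFrom p.1 w := by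
  refine restrict_evalFrom hmin w p fun x hx => ?_
  rcases h with h | h
  · exact Or.inl ((acc_of_isPrefix hx).trans h)
  · exact Or.inr (h.trans ⟨x, rfl⟩)

theorem branch_eval_of_acc {a : α} (w : List α)
    (h : A.Acc (A.dfa.evalFrom A.dfa.start w) q) :
    ((A.branch hmin hideal hq a).dfa.evalFrom (A.branch hmin hideal hq a).dfa.start w).1 =
      A.dfa.evalFrom A.dfa.start w :=
  branch_evalFrom_of_acc _ w (Or.inl h)

/-- Paths of `A` that end below `q` or start above its successor survive in the branch, and the
letter `a` joins the two parts. -/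
theorem branch_isTrim (htrim : A.IsTrim) (a : α) : (A.branch hmin hideal hq a).IsTrim := by
  have below : ∀ s t : (A.branch hmin hideal hq a).State, A.Acc t.1 q → A.Acc s.1 t.1 →
      (A.branch hmin hideal hq a).Acc s t := by
    rintro s t ht ⟨w, hw⟩
    exact ⟨w, Subtype.ext ((branch_evalFrom_of_acc s w (Or.inl (hw ▸ ht))).trans hw)⟩
  have above : ∀ s t : (A.branch hmin hideal hq a).State, A.Acc (A.dfa.step q a) s.1 →
      A.Acc s.1 t.1 → (A.branch hmin hideal hq a).Acc s t := by
    rintro s t hs ⟨w, hw⟩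
    exact ⟨w, Subtype.ext ((branch_evalFrom_of_acc s w (Or.inr hs)).trans hw)⟩
  let q' : (A.branch hmin hideal hq a).State := ⟨q, Or.inl (acc_refl q)⟩
  let r' : (A.branch hmin hideal hq a).State := ⟨A.dfa.step q a, Or.inr (acc_refl _)⟩
  have hqr : (A.branch hmin hideal hq a).Acc q' r' :=
    ⟨[a], restrict_step_eq hmin (t := q') (Or.inr (acc_refl _))⟩
  constructor
  · rintro ⟨t, ht | ht⟩
    · exact below _ ⟨t, Or.inl ht⟩ ht (hmin.acc_start t)
    · exact ((below _ q' (acc_refl q) (hmin.acc_start q)).trans hqr).trans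
        (above r' ⟨t, Or.inr ht⟩ (acc_refl _) ht)
  · rintro ⟨t, ht⟩
    obtain ⟨f, hf, hrf⟩ := htrim.2 (A.dfa.step q a)
    refine ⟨⟨f, Or.inr hrf⟩, hf, ?_⟩
    rcases ht with ht | ht
    · exact ((below ⟨t, Or.inl ht⟩ q' (acc_refl q) ht).trans hqr).trans
        (above r' ⟨f, Or.inr hrf⟩ (acc_refl _) hrf)
    · exact above ⟨t, Or.inr ht⟩ _ ht (acc_of_mem_accept hmin hideal htrim hf)

/-- If no state were lost, the `a`-successor of `q` would be a greater trunk state. -/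
theorem branch_size_lt (hmax : ∀ r, A.IsTrunk r → A.Acc q r → r = q) {a : α}
    (ha : A.dfa.step q a ≠ q) : (A.branch hmin hideal hq a).size < A.size := by
  have := A.finite
  obtain ⟨t, ht⟩ : ∃ t, t ∉ A.belowOrAbove q (A.dfa.step q a) := by
    by_contra! h
    refine ha (hmax _ (fun p hp s => ?_) (acc_step q a))
    rcases h p with h₁ | h₁
    · exact hq p h₁ s
    · obtain rfl := acc_antisymm hmin hideal hp h₁
      exact (h s).symm.imp id fun h₂ => h₂.trans (acc_step q a)
  exact Finite.card_subtype_lt (p := (· ∈ A.belowOrAbove q (A.dfa.step q a))) ht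

theorem exists_branch_eval {a₀ : α} (ha₀ : A.dfa.step q a₀ ≠ q) (w : List α) :
    ∃ a, A.dfa.step q a ≠ q ∧
      ((A.branch hmin hideal hq a).dfa.evalFrom (A.branch hmin hideal hq a).dfa.start w).1 =
        A.dfa.evalFrom A.dfa.start w := by
  induction w using List.reverseRecOn with
  | nil => exact ⟨a₀, ha₀, rfl⟩
  | append_singleton w b ih =>
    by_cases h₁ : A.Acc (A.dfa.evalFrom A.dfa.start (w ++ [b])) q
    · exact ⟨a₀, ha₀, branch_eval_of_acc _ h₁⟩
    obtain ⟨a, ha, hw, hT⟩ : ∃ a, A.dfa.step q a ≠ q ∧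
        ((A.branch hmin hideal hq a).dfa.evalFrom (A.branch hmin hideal hq a).dfa.start w).1 =
          A.dfa.evalFrom A.dfa.start w ∧
        A.dfa.evalFrom A.dfa.start (w ++ [b]) ∈ A.belowOrAbove q (A.dfa.step q a) := by
      by_cases h₂ : A.Acc (A.dfa.evalFrom A.dfa.start w) q
      -- The run may jump past `q`, so `a` is taken from a path from `q` to the new state, not from
      -- the word read. The earlier states are below `q`, hence common to all branches.
      · obtain ⟨a, ha, has⟩ := exists_letter_of_acc
          ((hq q (acc_refl q) (A.dfa.evalFrom A.dfa.start (w ++ [b]))).resolve_right h₁)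
          fun h => h₁ (h ▸ acc_refl _)
        exact ⟨a, ha, branch_eval_of_acc _ h₂, Or.inr has⟩
      · obtain ⟨a, ha, h⟩ := ih
        refine ⟨a, ha, h, Or.inr ?_⟩
        have h₃ := ((A.branch hmin hideal hq a).dfa.evalFrom
          (A.branch hmin hideal hq a).dfa.start w).2
        rw [h] at h₃
        exact (h₃.resolve_left h₂).trans (acc_of_isPrefix (List.prefix_append _ _))
    refine ⟨a, ha, ?_⟩
    rw [DFA.evalFrom_append_singleton] at hT ⊢
    rw [DFA.evalFrom_append_singleton]
    rw [← hw] at hT ⊢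
    exact congrArg Subtype.val (restrict_step_eq hmin hT)

end branch

/-- A minimal automaton recognizing an ideal that is not linear has a decomposition into trim
automata recognizing ideals, one for each letter at most. -/
theorem exists_decomposition_of_not_isLinear [Finite α] (hmin : A.IsMinimal)
    (hideal : A.lang.IsIdeal) (hlin : ¬ A.IsLinear) :
    ∃ (m : ℕ) (B : Fin m → FinAutomaton.{u, v} α), m ≤ Nat.card α ∧ A.IsDecomposition B ∧
        ∀ i, (B i).IsTrim ∧ (B i).lang.IsIdeal := by
  obtain ⟨q, hq, hmax⟩ := exists_maximal_isTrunk hmin hideal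
  have hne : ∃ s, ¬ A.Acc s q := by
    by_contra! h
    exact hlin (isLinear_of_total hmin hideal fun p => hq p (h p))
  obtain ⟨s, hs⟩ := hne
  have hsq : q ≠ s := fun h => hs (h ▸ acc_refl _)
  have htrim := isTrim_of_ne hmin hideal hsq
  obtain ⟨a₀, ha₀, -⟩ := exists_letter_of_acc ((hq q (acc_refl q) s).resolve_right hs) hsq
  let e := Finite.equivFin {a // A.dfa.step q a ≠ q}
  refine ⟨_, fun i => A.branch hmin hideal hq (e.symm i).1,
    Nat.card_le_card_of_injective _ Subtype.val_injective, ⟨?_, ?_, ?_⟩, ?_⟩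
  · exact Fin.pos (e ⟨a₀, ha₀⟩)
  · exact fun i => branch_size_lt hmax (e.symm i).2
  · refine fun w => ⟨fun h i => lang_le_restrict h, fun h => ?_⟩
    obtain ⟨a, ha, hw⟩ := exists_branch_eval (hmin := hmin) (hideal := hideal) (hq := hq) ha₀ w
    have := h (e ⟨a, ha⟩)
    simp only [Equiv.symm_apply_apply] at this
    rw [mem_lang_iff, ← hw]
    exact this
  · exact fun i => ⟨branch_isTrim htrim _, restrict_isIdeal hmin hideal⟩

variable {n : ℕ}

/-! ### Linear automata and ranks of states -/

theorem IsLinear.exists_enumeration (h : A.IsLinear) : ∃ n, Nonempty (A.Enumeration n) := by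
  classical
  have hlin : IsLinearOrder A.State A.Acc := h
  have := A.finite
  have := Fintype.ofFinite A.State
  let _ : LinearOrder A.State :=
    { le := A.Acc
      le_refl := hlin.refl
      le_trans := hlin.trans
      le_antisymm := hlin.antisymm
      le_total := hlin.total
      toDecidableLE := Classical.decRel _ }
  have hcard : Fintype.card A.State = Fintype.card A.State - 1 + 1 :=
    (Nat.sub_add_cancel (Fintype.card_pos_iff.2 ⟨A.dfa.start⟩)).symm
  let f := Fintype.orderIsoFinOfCardEq A.State hcard
  exact ⟨_, ⟨f.toEquiv, fun i j => f.le_iff_le⟩⟩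

namespace Enumeration

/-- The index of a state. -/
def rank (e : A.Enumeration n) (s : A.State) : ℕ := e.q.symm s

variable (e : A.Enumeration n)

theorem rank_q (i : Fin (n + 1)) : e.rank (e.q i) = i := by simp [rank]

theorem rank_le (s : A.State) : e.rank s ≤ n := Nat.le_of_lt_succ (e.q.symm s).2

theorem rank_inj {s t : A.State} : e.rank s = e.rank t ↔ s = t := by
  simp [rank, Fin.val_inj]

theorem rank_eq_iff {s : A.State} {i : Fin (n + 1)} : e.rank s = i ↔ s = e.q i := by
  rw [← e.rank_inj, rank_q]

theorem exists_rank {k : ℕ} (hk : k ≤ n) : ∃ s, e.rank s = k :=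
  ⟨e.q ⟨k, Nat.lt_succ_of_le hk⟩, e.rank_q _⟩

theorem acc_iff_rank {s t : A.State} : A.Acc s t ↔ e.rank s ≤ e.rank t := by
  have h := e.acc_iff (e.q.symm s) (e.q.symm t)
  rw [Equiv.apply_symm_apply, Equiv.apply_symm_apply] at h
  exact h

theorem rank_le_step (s : A.State) (a : α) : e.rank s ≤ e.rank (A.dfa.step s a) :=
  e.acc_iff_rank.1 (acc_step s a)

theorem size_eq (e : A.Enumeration n) : A.size = n + 1 := by
  have := Nat.card_congr e.q
  rw [Nat.card_fin] at this
  exact this.symm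

theorem rank_start (hmin : A.IsMinimal) : e.rank A.dfa.start = 0 := by
  obtain ⟨s, hs⟩ := e.exists_rank (Nat.zero_le n)
  have := e.acc_iff_rank.1 (hmin.acc_start s)
  omega

theorem rank_le_iff (hmin : A.IsMinimal) (hideal : A.lang.IsIdeal) {s t : A.State} :
    e.rank s ≤ e.rank t ↔ A.dfa.acceptsFrom s ≤ A.dfa.acceptsFrom t := by
  have key : ∀ {s t}, e.rank s ≤ e.rank t → A.dfa.acceptsFrom s ≤ A.dfa.acceptsFrom t :=
    fun h => acceptsFrom_le_of_acc hmin hideal (e.acc_iff_rank.2 h)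
  refine ⟨key, fun h => ?_⟩
  rcases le_total (e.rank s) (e.rank t) with h' | h'
  · exact h'
  · rw [hmin.acceptsFrom_injective (le_antisymm h (key h'))]

theorem rank_step_mono (hmin : A.IsMinimal) (hideal : A.lang.IsIdeal) {s t : A.State}
    (h : e.rank s ≤ e.rank t) (a : α) :
    e.rank (A.dfa.step s a) ≤ e.rank (A.dfa.step t a) := by
  rw [e.rank_le_iff hmin hideal] at h ⊢
  exact acceptsFrom_step_mono h a

theorem mem_accept_iff (hmin : A.IsMinimal) (hideal : A.lang.IsIdeal) (hn : 0 < n)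
    {s : A.State} : s ∈ A.dfa.accept ↔ e.rank s = n := by
  have htrim : A.IsTrim := isTrim_of_ne hmin hideal (p := e.q 0) (p' := e.q (Fin.last n)) (by
    rw [Ne, ← e.rank_inj, e.rank_q, e.rank_q]
    exact hn.ne)
  have hlast : e.q (Fin.last n) ∈ A.dfa.accept := by
    obtain ⟨f, hf, h⟩ := htrim.2 (e.q (Fin.last n))
    have h' := e.acc_iff_rank.1 h
    rw [e.rank_q] at h'
    rwa [← e.rank_eq_iff.1 (le_antisymm (e.rank_le f) h')]
  constructor
  · intro hs
    have h := e.acc_iff_rank.1 (acc_of_mem_accept hmin hideal htrim hs (q := e.q (Fin.last n)))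
    rw [e.rank_q] at h
    exact le_antisymm (e.rank_le s) h
  · intro hs
    rwa [e.rank_eq_iff (i := Fin.last n) |>.1 hs]

theorem exists_letter {s : A.State}
    (hs : e.rank s < n) : ∃ a, e.rank (A.dfa.step s a) = e.rank s + 1 := by
  obtain ⟨t, ht⟩ := e.exists_rank (k := e.rank s + 1) hs
  obtain ⟨a, ha, hat⟩ := exists_letter_of_acc (e.acc_iff_rank (s := s) (t := t).2 (by omega))
    fun h => by rw [h] at ht; omega
  refine ⟨a, ?_⟩
  have h₁ := e.acc_iff_rank.1 hat
  have h₂ := e.rank_le_step s a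
  have h₃ : e.rank (A.dfa.step s a) ≠ e.rank s := fun h => ha (e.rank_inj.1 h)
  omega

/-! ### Linear automata without damping pattern -/

/-- The concatenation of the words `xᵢ, …, xᵢ₊ₖ₋₁`. -/
def concat (x : ℕ → List α) (i k : ℕ) : List α := (List.range' i k).flatMap x

theorem concat_succ (x : ℕ → List α) (i k : ℕ) : concat x i (k + 1) = x i ++ concat x (i + 1) k := by
  simp [concat, List.range'_succ]

theorem concat_append (x : ℕ → List α) (i k l : ℕ) :
    concat x i k ++ concat x (i + k) l = concat x i (k + l) := by
  simp [concat, ← List.range'_append_1]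

variable {e}

theorem rank_concat {x : ℕ → List α}
    (hx : ∀ j < n, ∀ s, e.rank s = j → e.rank (A.dfa.evalFrom s (x j)) = j + 1) (k i : ℕ)
    (hik : i + k ≤ n) (s : A.State) (hs : e.rank s = i) :
    e.rank (A.dfa.evalFrom s (concat x i k)) = i + k := by
  induction k generalizing i s with
  | zero => exact hs
  | succ k ih =>
    rw [concat_succ, DFA.evalFrom_of_append, ih (i + 1) (by omega) _ (hx i (by omega) s hs)]
    omega

theorem le_rank_concat {x : ℕ → List α}
    (hx : ∀ j, j + 1 < n → ∀ s, j + 1 ≤ e.rank s → j + 2 ≤ e.rank (A.dfa.evalFrom s (x j)))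
    (k i : ℕ) (hik : i + k < n) (s : A.State) (hs : i + 1 ≤ e.rank s) :
    i + k + 1 ≤ e.rank (A.dfa.evalFrom s (concat x i k)) := by
  induction k generalizing i s with
  | zero => exact hs
  | succ k ih =>
    rw [concat_succ, DFA.evalFrom_of_append]
    have := ih (i + 1) (by omega) _ (hx i (by omega) s hs)
    omega

/-- A smaller factor reaches the same state after two prefixes `x₀ ⋯ xᵢ₋₁` and `x₀ ⋯ xⱼ₋₁`, `i < j`.
Continuing with `xᵢ ⋯ xₙ₋₂`, the longer one is accepted by `A`, as its lead of at least one state is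
never lost. So every factor accepts `x₀ ⋯ xₙ₋₂`, which `A` rejects. -/
theorem isPrime_of_words (hmin : A.IsMinimal) (hideal : A.lang.IsIdeal) {x : ℕ → List α}
    (hx₁ : ∀ j < n, ∀ s, e.rank s = j → e.rank (A.dfa.evalFrom s (x j)) = j + 1)
    (hx₂ : ∀ j, j + 1 < n → ∀ s, j + 1 ≤ e.rank s → j + 2 ≤ e.rank (A.dfa.evalFrom s (x j))) :
    A.IsPrime := by
  rintro ⟨m, B, hm, hsize, hlang⟩
  rcases Nat.eq_zero_or_pos n with rfl | hn
  -- A factor of a one-state automaton would have no state at all.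
  · have h := hsize ⟨0, hm⟩
    rw [e.size_eq, Nat.lt_one_iff] at h
    have := (B ⟨0, hm⟩).finite
    have : Nonempty (B ⟨0, hm⟩).State := ⟨(B ⟨0, hm⟩).dfa.start⟩
    exact Nat.card_pos.ne' h
  have hrank : ∀ k ≤ n, e.rank (A.dfa.evalFrom A.dfa.start (concat x 0 k)) = k := by
    intro k hk
    rw [rank_concat hx₁ k 0 (by omega) _ (e.rank_start hmin), zero_add]
  have hnot : concat x 0 (n - 1) ∉ A.lang := by
    rw [mem_lang_iff, e.mem_accept_iff hmin hideal hn, hrank _ (by omega)]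
    omega
  refine hnot ((hlang _).2 fun b => ?_)
  have := (B b).finite
  have := Fintype.ofFinite (B b).State
  obtain ⟨i, j, hij, heq⟩ : ∃ i j : Fin (n + 1), i < j ∧
      (B b).dfa.evalFrom (B b).dfa.start (concat x 0 i) =
        (B b).dfa.evalFrom (B b).dfa.start (concat x 0 j) := by
    obtain ⟨i, j, hne, heq⟩ := Fintype.exists_ne_map_eq_of_card_lt
      (fun i : Fin (n + 1) => (B b).dfa.evalFrom (B b).dfa.start (concat x 0 i)) (by
        have h := hsize b
        rw [e.size_eq, size, Nat.card_eq_fintype_card] at h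
        simpa using h)
    rcases lt_or_gt_of_ne hne with h | h
    · exact ⟨i, j, h, heq⟩
    · exact ⟨j, i, h, heq.symm⟩
  have hij' : (i : ℕ) < j := hij
  have hj : (j : ℕ) ≤ n := Nat.le_of_lt_succ j.2
  have hsplit := concat_append x 0 i (n - 1 - i)
  rw [zero_add, show (i : ℕ) + (n - 1 - i) = n - 1 by omega] at hsplit
  have hmem : concat x 0 j ++ concat x i (n - 1 - i) ∈ A.lang := by
    rw [mem_lang_iff, e.mem_accept_iff hmin hideal hn, DFA.evalFrom_of_append]
    have h := le_rank_concat hx₂ (n - 1 - i) i (by omega)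
      (A.dfa.evalFrom A.dfa.start (concat x 0 j)) (by rw [hrank _ hj]; omega)
    have h' := e.rank_le (A.dfa.evalFrom (A.dfa.evalFrom A.dfa.start (concat x 0 j))
      (concat x i (n - 1 - i)))
    omega
  have hB := (hlang _).1 hmem b
  rw [mem_lang_iff, DFA.evalFrom_of_append, ← heq, ← DFA.evalFrom_of_append, hsplit] at hB
  exact hB

theorem isPrime_of_not_hasDampingPattern (hmin : A.IsMinimal) (hideal : A.lang.IsIdeal)
    (e : A.Enumeration n) (hdamp : ∀ i j, ¬ e.IsDampingPattern i j) : A.IsPrime := by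
  have hx : ∀ j, ∃ x : List α,
      (j < n → ∀ s, e.rank s = j → e.rank (A.dfa.evalFrom s x) = j + 1) ∧
      (j + 1 < n → ∀ s, j + 1 ≤ e.rank s → j + 2 ≤ e.rank (A.dfa.evalFrom s x)) := by
    intro j
    by_cases hj : j < n
    swap
    · exact ⟨[], fun h => absurd h hj, fun h => absurd h (by omega)⟩
    obtain ⟨s, hs⟩ := e.exists_rank hj.le
    obtain ⟨b, hb⟩ := e.exists_letter (hs.symm ▸ hj)
    by_cases hj₁ : j + 1 < n
    swap
    · refine ⟨[b], fun _ t ht => ?_, fun h => absurd h hj₁⟩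
      obtain rfl := e.rank_inj.1 (ht.trans hs.symm)
      exact hb.trans (by omega)
    have hd := hdamp ⟨j, hj⟩ ⟨j + 1, hj₁⟩
    -- The letter `a` fixes `qⱼ` or leads to `qⱼ₊₁`, and does not fix `qⱼ₊₁`. The word is `a` if it
    -- leads to `qⱼ₊₁`, and otherwise `a` followed by a letter `b` that does.
    obtain ⟨a, ha, ha'⟩ := Set.not_subset.1 fun h => hd ⟨rfl, h⟩
    have hs' : e.q (Fin.castSucc ⟨j, hj⟩) = s := (e.rank_eq_iff.1 hs).symm
    obtain ⟨s₁, hs₁⟩ := e.exists_rank hj₁.le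
    have hs₁' : e.q (Fin.castSucc ⟨j + 1, hj₁⟩) = s₁ := (e.rank_eq_iff.1 hs₁).symm
    rw [hs', hs₁'] at ha
    rw [hs₁'] at ha'
    have hup : ∀ t, j + 1 ≤ e.rank t → j + 2 ≤ e.rank (A.dfa.step t a) := by
      intro t ht
      have h₁ := e.rank_step_mono hmin hideal (hs₁.le.trans ht) a
      have h₂ := e.rank_le_step s₁ a
      have h₃ : e.rank (A.dfa.step s₁ a) ≠ e.rank s₁ := fun h => ha' (e.rank_inj.1 h)
      omega
    rcases ha with ha | ha
    · refine ⟨[a, b], fun _ t ht => ?_, fun _ t ht => (hup t ht).trans (e.rank_le_step _ _)⟩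
      obtain rfl := e.rank_inj.1 (ht.trans hs.symm)
      change e.rank (A.dfa.step (A.dfa.step t a) b) = _
      rw [show A.dfa.step t a = t from ha, hb, hs]
    · refine ⟨[a], fun _ t ht => ?_, fun _ t ht => hup t ht⟩
      obtain rfl := e.rank_inj.1 (ht.trans hs.symm)
      exact (congrArg e.rank ha).trans hs₁
  choose x hx₁ hx₂ using hx
  exact isPrime_of_words hmin hideal hx₁ hx₂

/-! ### Reduced automata -/

variable (e)

theorem rank_redirect (k : Fin n) (s : A.State) :
    e.rank (e.redirect k s).1 = if e.rank s = k then (k : ℕ) + 1 else e.rank s := by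
  have h := e.rank_eq_iff (s := s) (i := k.castSucc)
  rw [Fin.val_castSucc] at h
  by_cases hs : s = e.q k.castSucc
  · rw [if_pos (h.2 hs), redirect, dif_pos hs, rank_q, Fin.val_succ]
  · rw [if_neg (mt h.1 hs), redirect, dif_neg hs]

theorem rank_ne (k : Fin n) (s : (e.reduced k).State) : e.rank s.1 ≠ k := fun h =>
  s.2 (e.rank_eq_iff.1 (h.trans (Fin.val_castSucc k).symm))

theorem rank_reduced_step (k : Fin n) (s : (e.reduced k).State) (a : α) :
    e.rank ((e.reduced k).dfa.step s a).1 =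
      if e.rank (A.dfa.step s.1 a) = k then (k : ℕ) + 1 else e.rank (A.dfa.step s.1 a) :=
  e.rank_redirect k _

theorem mem_reduced_accept (k : Fin n) (s : (e.reduced k).State) :
    s ∈ (e.reduced k).dfa.accept ↔ e.rank s.1 = n :=
  (e.rank_eq_iff (i := Fin.last n)).symm

theorem rank_le_reduced_step (k : Fin n) (s : (e.reduced k).State) (a : α) :
    e.rank s.1 ≤ e.rank ((e.reduced k).dfa.step s a).1 := by
  rw [rank_reduced_step]
  have := e.rank_le_step s.1 a
  split_ifs <;> omega

theorem reduced_size_lt (k : Fin n) : (e.reduced k).size < A.size := by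
  have := A.finite
  exact Finite.card_subtype_lt (p := (· ≠ e.q k.castSucc)) (x := e.q k.castSucc) (by simp)

theorem reduced_isIdeal (hmin : A.IsMinimal) (hideal : A.lang.IsIdeal) (k : Fin n) :
    (e.reduced k).lang.IsIdeal := by
  refine isIdeal_of_monotone (fun q r => e.rank q.1 ≤ e.rank r.1) le_rfl ?_ ?_ ?_
  · intro q r a h
    have := e.rank_step_mono hmin hideal h a
    rw [rank_reduced_step, rank_reduced_step]
    split_ifs <;> omega
  · exact fun q r a h => h.trans (e.rank_le_reduced_step k r a)
  · intro q r h hq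
    rw [mem_reduced_accept] at hq ⊢
    exact le_antisymm (e.rank_le _) (hq.symm.le.trans h)

theorem lang_le_reduced (hmin : A.IsMinimal) (hideal : A.lang.IsIdeal) (k : Fin n) {w : List α}
    (hw : w ∈ A.lang) : w ∈ (e.reduced k).lang := by
  have key : ∀ (w : List α) (q : A.State) (t : (e.reduced k).State), e.rank q ≤ e.rank t.1 →
      e.rank (A.dfa.evalFrom q w) ≤ e.rank ((e.reduced k).dfa.evalFrom t w).1 := by
    intro w
    induction w with
    | nil => exact fun q t h => h
    | cons a w ih =>
      intro q t h
      refine ih _ _ ?_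
      have := e.rank_step_mono hmin hideal h a
      rw [rank_reduced_step]
      split_ifs <;> omega
  rw [mem_lang_iff, e.mem_accept_iff hmin hideal k.pos] at hw
  rw [mem_lang_iff, mem_reduced_accept]
  refine le_antisymm (e.rank_le _) ?_
  refine hw.symm.le.trans (key w _ _ ?_)
  rw [e.rank_start hmin]
  exact Nat.zero_le _

/-- A letter raising the rank by one in `A` raises it by two here if it would hit `qₖ`. As the
target is not `qₖ`, this does not overshoot. -/
theorem reduced_acc_iff (k : Fin n)
    {s t : (e.reduced k).State} : (e.reduced k).Acc s t ↔ e.rank s.1 ≤ e.rank t.1 := by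
  constructor
  · rintro ⟨w, rfl⟩
    induction w generalizing s with
    | nil => exact le_rfl
    | cons a w ih => exact (e.rank_le_reduced_step k s a).trans ih
  · intro h
    obtain ⟨d, hd⟩ := Nat.exists_eq_add_of_le h
    induction d using Nat.strong_induction_on generalizing s with
    | _ d ih =>
      rcases Nat.eq_zero_or_pos d with rfl | hpos
      · rw [Subtype.ext (e.rank_inj.1 hd)]
        exact acc_refl _
      have htn := e.rank_le t.1
      have htk := e.rank_ne k t
      obtain ⟨a, ha⟩ := e.exists_letter (s := s.1) (by omega)
      have hstep := e.rank_reduced_step k s a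
      rw [ha] at hstep
      have h₁ : e.rank s.1 < e.rank ((e.reduced k).dfa.step s a).1 ∧
          e.rank ((e.reduced k).dfa.step s a).1 ≤ e.rank t.1 := by
        split_ifs at hstep <;> omega
      exact (acc_step s a).trans
        (ih (e.rank t.1 - e.rank ((e.reduced k).dfa.step s a).1) (by omega) h₁.2 (by omega))

theorem reduced_isLinear (k : Fin n) :
    (e.reduced k).IsLinear :=
  { refl := acc_refl
    trans := fun _ _ _ => Acc.trans
    antisymm := fun _ _ h₁ h₂ => Subtype.ext (e.rank_inj.1 (le_antisymm
      ((e.reduced_acc_iff k).1 h₁) ((e.reduced_acc_iff k).1 h₂)))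
    total := fun s t => by
      rw [e.reduced_acc_iff, e.reduced_acc_iff]
      exact le_total _ _ }

theorem reduced_isTrim (hmin : A.IsMinimal) (k : Fin n) :
    (e.reduced k).IsTrim := by
  constructor
  · intro q
    rw [e.reduced_acc_iff]
    have h₁ := e.rank_redirect k A.dfa.start
    have h₂ := e.rank_ne k q
    rw [e.rank_start hmin] at h₁
    change e.rank (e.redirect k A.dfa.start).1 ≤ _
    split_ifs at h₁ <;> omega
  · intro q
    have hne : e.q (Fin.last n) ≠ e.q k.castSucc := fun h =>
      (Fin.castSucc_lt_last k).ne' (e.q.injective h)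
    exact ⟨⟨e.q (Fin.last n), hne⟩, rfl, (e.reduced_acc_iff k).2
      ((e.rank_le _).trans (e.rank_q (Fin.last n)).ge)⟩

variable {e}

/-- While `A` is at or below `qⱼ`, the first reduced automaton follows it with `qᵢ` replaced by
`qⱼ`; while `A` is strictly below `qⱼ`, the second is exact. If `A` leaves through `qⱼ`, the first
is exact afterwards; if it jumps over `qⱼ`, the second is. -/
theorem IsDampingPattern.rank_evalFrom (hmin : A.IsMinimal) {i j : Fin n}
    (h : e.IsDampingPattern i j) (w : List α) :
    let s := e.rank (A.dfa.evalFrom A.dfa.start w)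
    let t := e.rank ((e.reduced i).dfa.evalFrom (e.reduced i).dfa.start w).1
    let t' := e.rank ((e.reduced j).dfa.evalFrom (e.reduced j).dfa.start w).1
    let P := t = if s = i then (i : ℕ) + 1 else s
    (P ∨ t' = s) ∧ (s < j → t' = s) ∧ (s ≤ j → P) := by
  obtain ⟨hij, hd⟩ := h
  induction w using List.reverseRecOn with
  | nil =>
    have h₁ : e.rank (e.reduced i).dfa.start.1 = _ := e.rank_redirect i A.dfa.start
    have h₂ : e.rank (e.reduced j).dfa.start.1 = _ := e.rank_redirect j A.dfa.start
    simp only [DFA.evalFrom_nil, h₁, h₂, e.rank_start hmin]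
    refine ⟨Or.inl trivial, fun h => if_neg h.ne, fun _ => trivial⟩
  | append_singleton w a ih =>
    simp only [DFA.evalFrom_append_singleton, rank_reduced_step]
    generalize A.dfa.evalFrom A.dfa.start w = s at *
    generalize (e.reduced i).dfa.evalFrom (e.reduced i).dfa.start w = t at *
    generalize (e.reduced j).dfa.evalFrom (e.reduced j).dfa.start w = t' at *
    obtain ⟨ih₁, ih₂, ih₃⟩ := ih
    have hsa := e.rank_le_step s a
    have htj := e.rank_ne j t'
    have hP : (e.rank s ≠ i ∧ e.rank t.1 = e.rank s) → t.1 = s := fun h => e.rank_inj.1 h.2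
    have hP' : e.rank t'.1 = e.rank s → t'.1 = s := e.rank_inj.1
    rcases lt_trichotomy (e.rank s) j with hs | hs | hs
    · rw [hP' (ih₂ hs)]
      have hif := ih₃ hs.le
      by_cases hsi : e.rank s = i
      · rw [if_pos hsi] at hif
        have hsi' : s = e.q i.castSucc := e.rank_eq_iff.1 hsi
        have htj' : t.1 = e.q j.castSucc := e.rank_eq_iff.1 (by rw [Fin.val_castSucc]; omega)
        have hfix : e.rank (A.dfa.step s a) ≤ j → e.rank (A.dfa.step t.1 a) = j := by
          intro hle
          have : a ∈ A.letters (e.q j.castSucc) (e.q j.castSucc) := by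
            refine hd ?_
            rcases Nat.lt_or_ge (e.rank (A.dfa.step s a)) j with h | h
            · refine Or.inl ?_
              change A.dfa.step _ a = _
              rw [← hsi', ← e.rank_inj]
              omega
            · refine Or.inr ?_
              change A.dfa.step _ a = _
              rw [← hsi', ← e.rank_inj, rank_q, Fin.val_castSucc]
              omega
          rw [htj', show A.dfa.step _ a = _ from this, rank_q, Fin.val_castSucc]
        split_ifs <;> omega
      · rw [if_neg hsi] at hif
        rw [e.rank_inj.1 hif]
        split_ifs <;> omega
    · have hif := ih₃ hs.le
      rw [if_neg (by omega)] at hif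
      rw [e.rank_inj.1 hif]
      split_ifs <;> omega
    · rcases ih₁ with hif | hif
      · rw [if_neg (by omega)] at hif
        rw [e.rank_inj.1 hif]
        split_ifs <;> omega
      · rw [e.rank_inj.1 hif]
        split_ifs <;> omega

theorem IsDampingPattern.isDecomposition (hmin : A.IsMinimal) (hideal : A.lang.IsIdeal)
    {i j : Fin n} (h : e.IsDampingPattern i j) :
    A.IsDecomposition ![e.reduced i, e.reduced j] := by
  refine ⟨by simp, ?_, fun w => ?_⟩
  · simp [Fin.forall_fin_two, reduced_size_lt]
  simp only [Fin.forall_fin_two, Matrix.cons_val_zero, Matrix.cons_val_one]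
  refine ⟨fun hw => ⟨e.lang_le_reduced hmin hideal i hw, e.lang_le_reduced hmin hideal j hw⟩,
    fun ⟨h₁, h₂⟩ => ?_⟩
  rw [mem_lang_iff, mem_reduced_accept] at h₁ h₂
  rw [mem_lang_iff, e.mem_accept_iff hmin hideal i.pos]
  have hij := h.1
  have hj := j.2
  rcases (h.rank_evalFrom hmin w).1 with hP | hP
  -- The replaced value `i + 1 = j` is less than `n`, so rank `n` is genuine.
  · rw [h₁] at hP
    split_ifs at hP <;> omega
  · omega

end Enumeration

end FinAutomaton

theorem mainTheorem3 {α : Type u} [Finite α] (A : FinAutomaton.{u, v} α)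
    (hmin : A.IsMinimal) (hideal : A.lang.IsIdeal) :
    (A.IsPrime ↔ A.IsLinear ∧ ¬ A.HasDampingPattern) ∧
    (A.IsComposite → A.IsLinear →
      ∃ (n : ℕ) (e : A.Enumeration n), (∃ i j, e.IsDampingPattern i j) ∧
        ∀ i j, e.IsDampingPattern i j →
          A.IsDecomposition ![e.reduced i, e.reduced j] ∧
          ∀ k ∈ ({i, j} : Set (Fin n)),
            (e.reduced k).IsTrim ∧ (e.reduced k).IsLinear ∧ (e.reduced k).lang.IsIdeal) ∧
    (¬ A.IsLinear →
      ∃ (m : ℕ) (B : Fin m → FinAutomaton.{u, v} α), m ≤ Nat.card α ∧ A.IsDecomposition B ∧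
        ∀ i, (B i).IsTrim ∧ (B i).lang.IsIdeal) := by
  have hnonlin := FinAutomaton.exists_decomposition_of_not_isLinear hmin hideal
  refine ⟨⟨fun hprime => ⟨?_, ?_⟩, ?_⟩, ?_, hnonlin⟩
  · by_contra hlin
    obtain ⟨m, B, -, hB, -⟩ := hnonlin hlin
    exact hprime ⟨m, B, hB⟩
  · rintro ⟨n, e, i, j, h⟩
    exact hprime ⟨2, _, h.isDecomposition hmin hideal⟩
  · rintro ⟨hlin, hdamp⟩
    obtain ⟨n, ⟨e⟩⟩ := hlin.exists_enumeration
    exact e.isPrime_of_not_hasDampingPattern hmin hideal fun i j h => hdamp ⟨n, e, i, j, h⟩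
  · intro hcomp hlin
    obtain ⟨n, ⟨e⟩⟩ := hlin.exists_enumeration
    refine ⟨n, e, ?_, fun i j h => ⟨h.isDecomposition hmin hideal, fun k _ =>
      ⟨e.reduced_isTrim hmin k, e.reduced_isLinear k,
        e.reduced_isIdeal hmin hideal k⟩⟩⟩
    by_contra! hdamp
    exact e.isPrime_of_not_hasDampingPattern hmin hideal hdamp hcomp
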